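/- A set $C\subseteq\mathbb{R}^n$ is a cone if $\alpha x\in C$ for all $x\in C$, $\alpha>0$. A cone is *proper* if it is closed, convex, pointed ($x,-x\in C$ implies $x=0$) and has nonempty interior. Its dual cone is $C^\vee=\{y\in\mathbb{R}^n : y^Tx\ge 0 \text{ for all } x\in C\}$, and $C$ is *self-dual* if $C^\vee=C$. Let $\operatorname{Aut}(C)$ be the set of matrices $L\in\mathbb{R}^{n\times n}$ with $L(C)=C$; $C$ is *homogeneous* if for all $x,y\in\operatorname{int}(C)$ there is $L\in\operatorname{Aut}(C)$ with $Lx=y$. Let $M(C)$ be the set of matrices $A\in\mathbb{R}^{n\times n}$ such that every solution of $\dot x(t)=Ax(t)$, $t\ge 0$, with $x(0)\in C$ satisfies $x(t)\in C$ for all $t\ge 0$. A matrix $A$ is *Hurwitz* if all its complex eigenvalues have negative real part. **Theorem.** Let $C\subset\mathbb{R}^n$ be a proper, homogeneous, self-dual cone, and let $A\in M(C)$ be Hurwitz. Then there exists a symmetric matrix $P\in\mathbb{R}^{n\times n}$ such that $P$ is an automorphism of $C$, that is, $P(C)=C=C^\vee$, and the quadratic form $V(x)=x^TPx$ is a Lyapunov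 function for $\dot x=Ax$: $V(0)=0$, $V(x)>0$ for all $x\neq 0$, and the derivative of $V$ along the vector field $Ax$ is negative at every $x\ne0$; equivalently, $P\succ 0$ and $PA+A^TP\prec 0$. -/

import Mathlib

open Matrix

namespace ConeLyapunov

/-- A set `C` in `ℝⁿ` is a cone if it is stable under multiplication by positive reals. -/
def IsCone {n : ℕ} (C : Set (Fin n → ℝ)) : Prop :=
  ∀ x ∈ C, ∀ α : ℝ, 0 < α → α • x ∈ C

/-- A proper cone: a closed, convex, pointed cone with nonempty interior. -/
structure IsProperCone {n : ℕ} (C : Set (Fin n → ℝ)) : Prop where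
  isCone : IsCone C
  isClosed : IsClosed C
  convex : Convex ℝ C
  pointed : ∀ x, x ∈ C → -x ∈ C → x = 0
  interior_nonempty : (interior C).Nonempty

/-- The dual cone `{y | yᵀ x ≥ 0 for all x ∈ C}` with respect to the standard inner product. -/
def dualCone {n : ℕ} (C : Set (Fin n → ℝ)) : Set (Fin n → ℝ) :=
  {y | ∀ x ∈ C, 0 ≤ y ⬝ᵥ x}

/-- `C` is self-dual if it equals its dual cone. -/
def IsSelfDual {n : ℕ} (C : Set (Fin n → ℝ)) : Prop :=
  dualCone C = C

/-- `Aut(C)`: the matrices that map `C` onto `C`. -/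
def coneAut {n : ℕ} (C : Set (Fin n → ℝ)) : Set (Matrix (Fin n) (Fin n) ℝ) :=
  {L | (fun x => L *ᵥ x) '' C = C}

/-- `C` is homogeneous if `Aut(C)` acts transitively on the interior of `C`. -/
def IsHomogeneous {n : ℕ} (C : Set (Fin n → ℝ)) : Prop :=
  ∀ x ∈ interior C, ∀ y ∈ interior C, ∃ L ∈ coneAut C, L *ᵥ x = y

/-- `x` is a solution of the linear system `ẋ = A x` on `[0, ∞)`. -/
def IsSolution {n : ℕ} (A : Matrix (Fin n) (Fin n) ℝ) (x : ℝ → Fin n → ℝ) : Prop :=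
  ∀ t : ℝ, 0 ≤ t → HasDerivWithinAt x (A *ᵥ x t) (Set.Ici 0) t

/-- `M(C)`: the matrices `A` such that `C` is a (forward) invariant set of `ẋ = A x`. -/
def invariantMatrices {n : ℕ} (C : Set (Fin n → ℝ)) : Set (Matrix (Fin n) (Fin n) ℝ) :=
  {A | ∀ x : ℝ → Fin n → ℝ, IsSolution A x → x 0 ∈ C → ∀ t : ℝ, 0 ≤ t → x t ∈ C}

/-- A real square matrix is Hurwitz if all its complex eigenvalues have negative real part. -/
def IsHurwitz {n : ℕ} (A : Matrix (Fin n) (Fin n) ℝ) : Prop :=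
  ∀ μ ∈ spectrum ℂ (A.map (fun a : ℝ => (a : ℂ))), μ.re < 0

/-- `V` is a (global, strict) Lyapunov function for `ẋ = A x` at the equilibrium `0`: it is
continuously differentiable, zero at `0`, positive elsewhere, and its derivative along the vector
field is negative away from `0`. -/
structure IsLyapunovFunction {n : ℕ} (A : Matrix (Fin n) (Fin n) ℝ)
    (V : (Fin n → ℝ) → ℝ) : Prop where
  contDiff : ContDiff ℝ 1 V
  map_zero : V 0 = 0
  pos : ∀ x, x ≠ 0 → 0 < V x
  deriv_neg : ∀ x, x ≠ 0 → fderiv ℝ V x (A *ᵥ x) < 0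

end ConeLyapunov

/-!
The proof rests on a scaling property of the cone: for interior points `x₀`, `y₀` there is an
automorphism `R` of `C` with `Rᵀ R x₀ = y₀` (`exists_adjoint_apply_apply_eq`).

Membership `A ∈ M(C)` makes `A` cross-positive, and since `A` is Hurwitz, both `A` and `Aᵀ` map
some interior points `x₀`, `y₀` of `C` into `-int C` (`CrossPositive.exists_apply_eq_neg`). Scale
with `Rᵀ R x₀ = y₀` and pass to `F = R A R⁻¹`. The symmetric matrix `F + Fᵀ` is cross-positive and
maps the interior point `R x₀` into `-int C`, so its eigenvalues are negative
(`CrossPositive.eigenvalue_neg`). Hence `P = Rᵀ R` satisfies `P A + Aᵀ P ≺ 0`, and it is an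
automorphism of `C` because self-duality makes `Aut(C)` stable under transposition.

Scaling is proved without Jordan algebras. The Lie algebra of `Aut(C)` is described by linear
conditions at boundary pairs of `C` (`tangentOps`). Let `e` be an interior point fixed by all
isometric automorphisms (`exists_fixed_of_isometry`), so that `Xᵀ e = X e` for every `X` in the Lie
algebra. The function `g ↦ ⟪y₀, g e⟫ + ⟪g⁻¹ x₀, e⟫` attains its minimum on `Aut(C)`, and
stationarity says that `gᵀ y₀ - g⁻¹ x₀` is orthogonal to all `X e`. Homogeneity gives every
vector the form `X e` (`exists_tangentOps_apply_eq`), so `gᵀ y₀ = g⁻¹ x₀`, and `R = g⁻¹` works.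
-/

namespace ConeLyapunov

open Filter Topology Set
open scoped RealInnerProductSpace InnerProduct

section

variable {E : Type*} [NormedAddCommGroup E] [InnerProductSpace ℝ E]

/-! ### Self-dual cones in an inner product space -/

/-- A set that coincides with its dual cone; such a set is automatically a closed convex cone. -/
def IsInnerSelfDual (C : Set E) : Prop :=
  ∀ x, x ∈ C ↔ ∀ y ∈ C, 0 ≤ ⟪y, x⟫

namespace IsInnerSelfDual

variable {C : Set E}

lemma inner_nonneg (hC : IsInnerSelfDual C) {x y : E} (hx : x ∈ C) (hy : y ∈ C) : 0 ≤ ⟪x, y⟫ :=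
  (hC y).1 hy x hx

lemma zero_mem (hC : IsInnerSelfDual C) : (0 : E) ∈ C := (hC 0).2 (by simp)

lemma add_mem (hC : IsInnerSelfDual C) {x y : E} (hx : x ∈ C) (hy : y ∈ C) : x + y ∈ C :=
  (hC _).2 fun z hz => by
    rw [inner_add_right]
    exact add_nonneg (hC.inner_nonneg hz hx) (hC.inner_nonneg hz hy)

lemma smul_mem (hC : IsInnerSelfDual C) {x : E} (hx : x ∈ C) {a : ℝ} (ha : 0 ≤ a) : a • x ∈ C :=
  (hC _).2 fun z hz => by
    rw [inner_smul_right]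
    exact mul_nonneg ha (hC.inner_nonneg hz hx)

lemma isClosed (hC : IsInnerSelfDual C) : IsClosed C := by
  have : C = ⋂ y ∈ C, {x | 0 ≤ ⟪y, x⟫} := by
    ext x
    simpa using hC x
  rw [this]
  exact isClosed_biInter fun y _ => isClosed_le continuous_const (by fun_prop)

lemma norm_le_of_add_mem_of_sub_mem (hC : IsInnerSelfDual C) {w z : E} (h₁ : w + z ∈ C)
    (h₂ : w - z ∈ C) : ‖z‖ ≤ ‖w‖ := by
  have h := hC.inner_nonneg h₁ h₂
  simp only [inner_add_left, inner_sub_right, real_inner_self_eq_norm_sq] at h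
  rw [real_inner_comm w z] at h
  exact abs_le_of_sq_le_sq' (by linarith) (norm_nonneg _) |>.2

lemma mul_norm_le_inner (hC : IsInnerSelfDual C) {w z : E} {r : ℝ} (hr : 0 ≤ r)
    (hw : Metric.closedBall w r ⊆ C) (hz : z ∈ C) : r * ‖z‖ ≤ ⟪w, z⟫ := by
  rcases eq_or_ne z 0 with rfl | hz0
  · simp
  have hn : 0 < ‖z‖ := norm_pos_iff.2 hz0
  have hm : w - (r / ‖z‖) • z ∈ C := by
    apply hw
    rw [mem_closedBall_iff_norm, sub_sub_cancel_left, norm_neg, norm_smul, Real.norm_eq_abs,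
      abs_of_nonneg (by positivity), div_mul_cancel₀ _ hn.ne']
  have h := hC.inner_nonneg hm hz
  rw [inner_sub_left, inner_smul_left, real_inner_self_eq_norm_sq] at h
  have : r / ‖z‖ * ‖z‖ ^ 2 = r * ‖z‖ := by field_simp
  simp only [conj_trivial] at h
  linarith

lemma inner_pos_of_mem_interior (hC : IsInnerSelfDual C) {x y : E} (hx : x ∈ interior C)
    (hy : y ∈ C) (hy0 : y ≠ 0) : 0 < ⟪y, x⟫ := by
  obtain ⟨r, hr, hb⟩ := Metric.nhds_basis_closedBall.mem_iff.1 (mem_interior_iff_mem_nhds.1 hx)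
  have := hC.mul_norm_le_inner hr.le hb hy
  rw [real_inner_comm]
  have hn : 0 < ‖y‖ := norm_pos_iff.2 hy0
  nlinarith [mul_pos hr hn]

lemma interior_add_mem (hC : IsInnerSelfDual C) {x y : E} (hx : x ∈ interior C) (hy : y ∈ C) :
    x + y ∈ interior C := by
  have : (fun z => z + y) '' interior C ⊆ interior C := by
    apply interior_maximal
    · rintro _ ⟨z, hz, rfl⟩
      exact hC.add_mem (interior_subset hz) hy
    · exact (isOpenMap_add_right y) _ isOpen_interior
  exact this ⟨x, hx, rfl⟩

lemma interior_smul_mem (hC : IsInnerSelfDual C) {x : E} (hx : x ∈ interior C) {a : ℝ}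
    (ha : 0 < a) : a • x ∈ interior C := by
  have : (fun z => a • z) '' interior C ⊆ interior C := by
    apply interior_maximal
    · rintro _ ⟨z, hz, rfl⟩
      exact hC.smul_mem (interior_subset hz) ha.le
    · exact (isOpenMap_smul₀ ha.ne') _ isOpen_interior
  exact this ⟨x, hx, rfl⟩

variable [FiniteDimensional ℝ E]

/-- Strict positivity on the compact set of unit vectors of the cone is uniform, and therefore
stable under small perturbations. -/
lemma mem_interior (hC : IsInnerSelfDual C) {x : E} (h : ∀ y ∈ C, y ≠ 0 → 0 < ⟪y, x⟫) :
    x ∈ interior C := by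
  have hK : IsCompact (Metric.sphere (0 : E) 1 ∩ C) :=
    (isCompact_sphere 0 1).inter_right hC.isClosed
  have hm : ∃ m > 0, ∀ y ∈ Metric.sphere (0 : E) 1 ∩ C, m ≤ ⟪y, x⟫ := by
    rcases (Metric.sphere (0 : E) 1 ∩ C).eq_empty_or_nonempty with he | hne
    · exact ⟨1, one_pos, by simp [he]⟩
    · obtain ⟨y, hy, hmin⟩ := hK.exists_isMinOn hne
        (f := fun y => ⟪y, x⟫) (by fun_prop)
      refine ⟨⟪y, x⟫, h y hy.2 ?_, fun z hz => hmin hz⟩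
      rintro rfl
      simpa using hy.1
  obtain ⟨m, hm0, hm⟩ := hm
  have hm' : ∀ y ∈ C, m * ‖y‖ ≤ ⟪y, x⟫ := by
    intro y hy
    rcases eq_or_ne y 0 with rfl | hy0
    · simp
    have hn : 0 < ‖y‖ := norm_pos_iff.2 hy0
    have := hm (‖y‖⁻¹ • y) ⟨by simp [norm_smul, hn.ne'], hC.smul_mem hy (by positivity)⟩
    rw [inner_smul_left, conj_trivial, inv_mul_eq_div, le_div_iff₀ hn] at this
    exact this
  rw [mem_interior_iff_mem_nhds]
  refine Metric.nhds_basis_closedBall.mem_iff.2 ⟨m, hm0, fun z hz => (hC z).2 fun y hy => ?_⟩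
  have h1 : ‖z - x‖ ≤ m := mem_closedBall_iff_norm.1 hz
  have h2 := abs_le.1 (abs_real_inner_le_norm y (z - x))
  have h3 : ⟪y, z⟫ = ⟪y, x⟫ + ⟪y, z - x⟫ := by rw [inner_sub_right]; ring
  have h4 := hm' y hy
  nlinarith [mul_le_mul_of_nonneg_left h1 (norm_nonneg y)]

/-- A boundary point of the cone is orthogonal to some nonzero vector of the cone. -/
lemma exists_inner_eq_zero (hC : IsInnerSelfDual C) {x : E} (hx : x ∈ C)
    (hx' : x ∉ interior C) : ∃ y ∈ C, y ≠ 0 ∧ ⟪y, x⟫ = 0 := by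
  by_contra! hcon
  exact hx' (hC.mem_interior fun y hy hy0 =>
    lt_of_le_of_ne (hC.inner_nonneg hy hx) (hcon y hy hy0).symm)

/-- First-exit principle for curves starting in the interior of the cone. -/
lemma mem_interior_of_curve (hC : IsInnerSelfDual C) {γ : ℝ → E} {T : ℝ} (hT : 0 ≤ T)
    (hγ : ContinuousOn γ (Icc 0 T)) (h0 : γ 0 ∈ interior C)
    (hstep : ∀ t ∈ Ioc 0 T, (∀ s ∈ Ico 0 t, γ s ∈ interior C) → γ t ∈ C →
      ∀ y ∈ C, y ≠ 0 → ⟪y, γ t⟫ ≠ 0) :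
    γ T ∈ interior C := by
  by_contra hnot
  set S : Set ℝ := Icc 0 T ∩ γ ⁻¹' (interior C)ᶜ with hS
  have hScl : IsClosed S :=
    hγ.preimage_isClosed_of_isClosed isClosed_Icc isOpen_interior.isClosed_compl
  have hSc : IsCompact S := isCompact_Icc.of_isClosed_subset hScl inter_subset_left
  obtain ⟨t, htS, htmin⟩ := hSc.exists_isLeast ⟨T, right_mem_Icc.2 hT, hnot⟩
  have ht0 : 0 < t := lt_of_le_of_ne htS.1.1 (by rintro rfl; exact htS.2 h0)
  have hbefore : ∀ s ∈ Ico 0 t, γ s ∈ interior C := by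
    intro s hs
    by_contra hsn
    exact absurd (htmin ⟨⟨hs.1, hs.2.le.trans htS.1.2⟩, hsn⟩) (not_le.2 hs.2)
  have htC : γ t ∈ C := by
    have hlim : Tendsto γ (𝓝[Ico 0 t] t) (𝓝 (γ t)) :=
      (hγ t htS.1).mono_left (nhdsWithin_mono _ fun s hs => ⟨hs.1, hs.2.le.trans htS.1.2⟩)
    have : (𝓝[Ico 0 t] t).NeBot := by
      rw [← mem_closure_iff_nhdsWithin_neBot, closure_Ico ht0.ne]
      exact right_mem_Icc.2 ht0.le
    exact hC.isClosed.mem_of_tendsto hlim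
      (eventually_nhdsWithin_of_forall fun s hs => interior_subset (hbefore s hs))
  obtain ⟨y, hy, hy0, hyt⟩ := hC.exists_inner_eq_zero htC htS.2
  exact hstep t ⟨ht0, htS.1.2⟩ hbefore htC y hy hy0 hyt

end IsInnerSelfDual

end

section

variable {E : Type*} [NormedAddCommGroup E] [InnerProductSpace ℝ E]

/-! ### Cross-positive operators -/

/-- Cross-positivity of `A` on a self-dual cone `C`: at a boundary point of `C`, the vector field
`A` points into every supporting half-space. -/
def CrossPositive (C : Set E) (A : E →L[ℝ] E) : Prop :=
  ∀ x ∈ C, ∀ y ∈ C, ⟪y, x⟫ = 0 → 0 ≤ ⟪y, A x⟫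

namespace CrossPositive

variable {C : Set E} {A B : E →L[ℝ] E}

lemma add (hA : CrossPositive C A) (hB : CrossPositive C B) : CrossPositive C (A + B) := by
  intro x hx y hy hxy
  rw [_root_.add_apply, inner_add_right]
  exact add_nonneg (hA x hx y hy hxy) (hB x hx y hy hxy)

lemma adjoint [CompleteSpace E] (hA : CrossPositive C A) : CrossPositive C (A†) := by
  intro x hx y hy hxy
  rw [ContinuousLinearMap.adjoint_inner_right, real_inner_comm]
  exact hA y hy x hx (by rwa [real_inner_comm])

variable [FiniteDimensional ℝ E]

/-- The resolvent path `θ ↦ ((1 - θ) - θ A)⁻¹ c` starts at `c` and ends at `-A⁻¹ c`;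
cross-positivity keeps it from reaching the boundary of the cone. -/
theorem exists_apply_eq_neg (hC : IsInnerSelfDual C) (hA : CrossPositive C A)
    (hres : ∀ s : ℝ, 0 ≤ s → IsUnit (s • (1 : E →L[ℝ] E) - A)) {c : E} (hc : c ∈ interior C) :
    ∃ x ∈ interior C, A x = -c := by
  set D : ℝ → E →L[ℝ] E := fun θ => (1 - θ) • 1 - θ • A with hD
  have hunit : ∀ θ ∈ Icc (0 : ℝ) 1, IsUnit (D θ) := by
    intro θ hθ
    rcases hθ.1.eq_or_lt with rfl | h0
    · simp [hD]
    · have hs := hres ((1 - θ) / θ) (div_nonneg (by linarith [hθ.2]) h0.le)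
      have hDθ : D θ = θ • (((1 - θ) / θ) • (1 : E →L[ℝ] E) - A) := by
        rw [smul_sub, smul_smul, mul_div_cancel₀ _ h0.ne']
      rw [hDθ]
      exact hs.smul (Units.mk0 θ h0.ne')
  have happ : ∀ θ ∈ Icc (0 : ℝ) 1, D θ (Ring.inverse (D θ) c) = c := by
    intro θ hθ
    rw [← mul_apply_eq_comp, Ring.mul_inverse_cancel _ (hunit θ hθ)]
    rfl
  have hcont : ContinuousOn (fun θ => Ring.inverse (D θ) c) (Icc 0 1) := by
    intro θ hθ
    obtain ⟨u, hu⟩ := hunit θ hθ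
    have h1 : ContinuousAt (fun θ => Ring.inverse (D θ)) θ := by
      refine ContinuousAt.comp (g := Ring.inverse) (f := D) ?_ ?_
      · rw [← hu]
        exact NormedRing.inverse_continuousAt u
      · exact Continuous.continuousAt (by fun_prop)
    exact (h1.clm_apply continuousAt_const).continuousWithinAt
  have hend := hC.mem_interior_of_curve zero_le_one hcont (by simpa [hD] using hc) (by
    intro t ht _ htC y hy hy0 hyt
    have h1 := hA _ htC y hy hyt
    have h2 := hC.inner_pos_of_mem_interior hc hy hy0
    have h3 := congrArg (fun v => ⟪y, v⟫) (happ t ⟨ht.1.le, ht.2⟩)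
    simp only [hD, _root_.sub_apply, _root_.smul_apply,
      one_apply_eq_self, inner_sub_right, inner_smul_right] at h3 hyt h1
    rw [hyt] at h3
    nlinarith [mul_nonneg ht.1.le h1])
  refine ⟨_, hend, ?_⟩
  have h1 := happ 1 (right_mem_Icc.2 zero_le_one)
  simp only [hD, sub_self, zero_smul, one_smul, zero_sub, _root_.neg_apply] at h1 ⊢
  rw [← h1, neg_neg, h1]

/-- If the vector field `B` points strictly into `-C` at some interior point `z` of `C`, then every
real eigenvalue of `B` is negative: follow the line from `z` along an eigenvector `x` up to the
boundary of the cone, and compare `B` there with the supporting functional. -/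
theorem eigenvalue_neg (hC : IsInnerSelfDual C) (hB : CrossPositive C B) {z : E}
    (hz : z ∈ interior C) (hBz : -B z ∈ interior C) {x : E} {μ : ℝ} (hx0 : x ≠ 0)
    (hx : B x = μ • x) : μ < 0 := by
  wlog hxC : x ∉ C generalizing x
  · refine this (x := -x) (neg_ne_zero.2 hx0) (by rw [map_neg, hx, smul_neg]) fun hneg => ?_
    have h := hC.inner_nonneg (not_not.1 hxC) hneg
    rw [inner_neg_right] at h
    exact hx0 (real_inner_self_nonpos.1 (by linarith : ⟪x, x⟫ ≤ 0))
  by_contra! hμ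
  obtain ⟨y, hy, hyx⟩ : ∃ y ∈ C, ⟪y, x⟫ < 0 := by
    by_contra! h
    exact hxC ((hC x).2 h)
  have hy0 : y ≠ 0 := by
    rintro rfl
    simp at hyx
  have hyz := hC.inner_pos_of_mem_interior hz hy hy0
  -- at this parameter the line has left the interior of the cone, as `y` shows
  set T : ℝ := ⟪y, z⟫ / -⟪y, x⟫ with hT
  have hT0 : 0 ≤ T := div_nonneg hyz.le (by linarith)
  have hend := hC.mem_interior_of_curve (γ := fun t => z + t • x) hT0 (by fun_prop) (by simpa) (by
    intro t ht _ htC w hw hw0 hwt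
    have h1 := hB _ htC w hw hwt
    have h2 := hC.inner_pos_of_mem_interior hBz hw hw0
    have h3 := hC.inner_pos_of_mem_interior hz hw hw0
    simp only [map_add, map_smul, hx, inner_add_right, inner_smul_right, inner_neg_right]
      at h1 h2 hwt
    nlinarith [mul_nonneg hμ h3.le])
  have h4 := hC.inner_pos_of_mem_interior hend hy hy0
  rw [inner_add_right, inner_smul_right] at h4
  have h5 : T * ⟪y, x⟫ = -⟪y, z⟫ := by
    rw [hT, div_neg, neg_mul, div_mul_cancel₀ _ hyx.ne]
  linarith

end CrossPositive

/-- The algebra of bounded operators is a rational algebra, as the lemmas on `NormedSpace.exp`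
require. -/
noncomputable local instance : NormedAlgebra ℚ (E →L[ℝ] E) := NormedAlgebra.restrictScalars ℚ ℝ _

lemma exp_mul_exp_neg [CompleteSpace E] (X : E →L[ℝ] E) :
    NormedSpace.exp X * NormedSpace.exp (-X) = 1 := by
  rw [← NormedSpace.exp_add_of_commute (Commute.neg_right (Commute.refl X)), add_neg_cancel,
    NormedSpace.exp_zero]

lemma continuous_exp [CompleteSpace E] :
    Continuous (NormedSpace.exp : (E →L[ℝ] E) → (E →L[ℝ] E)) :=
  NormedSpace.exp_continuous

lemma hasDerivAt_exp_smul_apply [CompleteSpace E] (X : E →L[ℝ] E) (x : E) (t : ℝ) :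
    HasDerivAt (fun s : ℝ => NormedSpace.exp (s • X) x) (X (NormedSpace.exp (t • X) x)) t := by
  have h := (hasDerivAt_exp_smul_const' (𝕂 := ℝ) X t).clm_apply (hasDerivAt_const t x)
  simpa using h

variable [FiniteDimensional ℝ E] {C : Set E} {A : E →L[ℝ] E}

/-- The strict case: adding a positive rank-one operator makes the field point strictly inwards at
every boundary point, so no trajectory can leave the interior. -/
lemma CrossPositive.exp_add_rankOne_mem (hC : IsInnerSelfDual C) (hA : CrossPositive C A)
    {e x : E} (he : e ∈ interior C) (hx : x ∈ interior C) {ε : ℝ} (hε : 0 < ε) {t : ℝ}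
    (ht : 0 ≤ t) (hx0 : x ≠ 0) :
    NormedSpace.exp (t • (A + ε • InnerProductSpace.rankOne ℝ e e)) x ∈ interior C := by
  set A' := A + ε • InnerProductSpace.rankOne ℝ e e with hA'
  have hder := hasDerivAt_exp_smul_apply A' x
  refine hC.mem_interior_of_curve (γ := fun s => NormedSpace.exp (s • A') x) ht
    (fun s _ => (hder s).continuousAt.continuousWithinAt) (by simpa [NormedSpace.exp_zero]) ?_
  intro s hs hbefore hsC y hy hy0 hys
  set w := NormedSpace.exp (s • A') x with hw
  -- the flow is invertible, so the trajectory never vanishes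
  have hw0 : w ≠ 0 := by
    intro h0
    have h1 : NormedSpace.exp (-(s • A')) w = x := by
      have := exp_mul_exp_neg (-(s • A'))
      rw [neg_neg] at this
      rw [hw, ← mul_apply_eq_comp, this, one_apply_eq_self]
    rw [h0, map_zero] at h1
    exact hx0 h1.symm
  have hpos : 0 < ⟪y, A' w⟫ := by
    have h1 := hA w hsC y hy hys
    have h2 := hC.inner_pos_of_mem_interior he hy hy0
    have h3 := hC.inner_pos_of_mem_interior he hsC hw0
    have h4 : ⟪y, A' w⟫ = ⟪y, A w⟫ + ε * (⟪w, e⟫ * ⟪y, e⟫) := by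
      simp only [hA', _root_.add_apply, _root_.smul_apply,
        InnerProductSpace.rankOne_apply, inner_add_right, inner_smul_right, real_inner_comm w e]
    rw [h4]
    positivity
  have hd : HasDerivAt (fun s => ⟪y, NormedSpace.exp (s • A') x⟫) ⟪y, A' w⟫ s := by
    have := (hasDerivAt_const s y).inner ℝ (hder s)
    simpa using this
  -- a positive derivative at a zero forces negative values just before it
  have hslope := hd.tendsto_slope.eventually (lt_mem_nhds hpos)
  have hleft : ∀ᶠ r in 𝓝[<] s, 0 < slope (fun s => ⟪y, NormedSpace.exp (s • A') x⟫) s r :=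
    hslope.filter_mono (nhdsWithin_mono _ fun r hr => ne_of_lt hr)
  obtain ⟨r, hr, hr'⟩ := (hleft.and (Ico_mem_nhdsLT hs.1)).exists
  have hry := hC.inner_nonneg hy (interior_subset (hbefore r hr'))
  rw [slope_def_field, hys, sub_zero] at hr
  exact absurd hr (not_lt.2 (div_nonpos_of_nonneg_of_nonpos hry (by linarith [hr'.2])))

/-- The flow of a cross-positive operator preserves the cone. -/
theorem CrossPositive.exp_mem (hC : IsInnerSelfDual C) (hne : (interior C).Nonempty)
    (hA : CrossPositive C A) {x : E} (hx : x ∈ C) : NormedSpace.exp A x ∈ C := by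
  obtain ⟨e, he⟩ := hne
  by_cases htriv : ∃ v : E, v ≠ 0
  swap
  · push Not at htriv
    rw [htriv (NormedSpace.exp A x)]
    exact hC.zero_mem
  -- perturb both the operator and the initial point into the strict case, and let `ε → 0`
  set f : ℝ → E := fun ε =>
    NormedSpace.exp (A + ε • InnerProductSpace.rankOne ℝ e e) (x + ε • e) with hf
  have hfc : Continuous f :=
    (continuous_exp.comp (by fun_prop)).clm_apply (by fun_prop)
  have hlim : Tendsto f (𝓝[>] 0) (𝓝 (NormedSpace.exp A x)) := by
    have := hfc.tendsto 0
    simp only [hf, zero_smul, add_zero] at this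
    exact this.mono_left nhdsWithin_le_nhds
  refine hC.isClosed.mem_of_tendsto hlim (eventually_nhdsWithin_of_forall fun ε hε => ?_)
  have hxe : x + ε • e ∈ interior C := by
    rw [add_comm]
    exact hC.interior_add_mem (hC.interior_smul_mem he hε) hx
  have hxe0 : x + ε • e ≠ 0 := by
    intro h0
    rw [h0] at hxe
    obtain ⟨v, hv⟩ := htriv
    have hC0 : ∀ w ∈ C, w = 0 := by
      intro w hw
      by_contra hw0
      simpa using hC.inner_pos_of_mem_interior hxe hw hw0
    have h1 : v ∈ C := (hC v).2 fun y hy => by simp [hC0 y hy]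
    exact hv (hC0 v h1)
  have := hA.exp_add_rankOne_mem hC he hxe hε zero_le_one hxe0
  rw [one_smul] at this
  exact interior_subset this

end

section

variable {E : Type*} [NormedAddCommGroup E] [InnerProductSpace ℝ E]

/-! ### The automorphism group of a self-dual cone -/

/-- The automorphisms `g` of the cone `C`, encoded as pairs `(g, g⁻¹)`. Recording the inverse makes
the group a closed subset of the space of pairs of operators, so that compactness arguments do not
have to control invertibility separately. -/
def autPairs (C : Set E) : Set ((E →L[ℝ] E) × (E →L[ℝ] E)) :=
  {p | p.1 * p.2 = 1 ∧ p.2 * p.1 = 1 ∧ MapsTo p.1 C C ∧ MapsTo p.2 C C}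

namespace autPairs

variable {C : Set E} {p q : (E →L[ℝ] E) × (E →L[ℝ] E)}

lemma one_mem : ((1, 1) : (E →L[ℝ] E) × (E →L[ℝ] E)) ∈ autPairs C :=
  ⟨one_mul 1, one_mul 1, mapsTo_id C, mapsTo_id C⟩

lemma swap_mem (hp : p ∈ autPairs C) : (p.2, p.1) ∈ autPairs C :=
  ⟨hp.2.1, hp.1, hp.2.2.2, hp.2.2.1⟩

lemma mul_mem (hp : p ∈ autPairs C) (hq : q ∈ autPairs C) :
    (p.1 * q.1, q.2 * p.2) ∈ autPairs C := by
  refine ⟨?_, ?_, hp.2.2.1.comp hq.2.2.1, hq.2.2.2.comp hp.2.2.2⟩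
  · rw [mul_assoc, ← mul_assoc q.1, hq.1, one_mul, hp.1]
  · rw [mul_assoc, ← mul_assoc p.2, hp.2.1, one_mul, hq.2.1]

lemma fst_snd (hp : p ∈ autPairs C) (x : E) : p.1 (p.2 x) = x := by
  rw [← mul_apply_eq_comp, hp.1, one_apply_eq_self]

lemma snd_fst (hp : p ∈ autPairs C) (x : E) : p.2 (p.1 x) = x := fst_snd (swap_mem hp) x

lemma isClosed (hC : IsInnerSelfDual C) : IsClosed (autPairs C) := by
  have hmaps : IsClosed {g : E →L[ℝ] E | MapsTo g C C} := by
    have : {g : E →L[ℝ] E | MapsTo g C C} = ⋂ x ∈ C, {g | g x ∈ C} := by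
      ext g
      simp [MapsTo]
    rw [this]
    exact isClosed_biInter fun x _ => hC.isClosed.preimage (by fun_prop)
  refine (isClosed_eq (by fun_prop) continuous_const).inter
    ((isClosed_eq (by fun_prop) continuous_const).inter
      ((hmaps.preimage continuous_fst).inter (hmaps.preimage continuous_snd)))

lemma mapsTo_interior (hp : p ∈ autPairs C) : MapsTo p.1 (interior C) (interior C) := by
  have : p.2 ⁻¹' interior C ⊆ interior C := by
    apply interior_maximal
    · intro x hx
      rw [← fst_snd hp x]
      exact hp.2.2.1 (interior_subset hx)
    · exact isOpen_interior.preimage p.2.continuous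
  intro x hx
  apply this
  rwa [mem_preimage, snd_fst hp]

lemma adjoint_mapsTo [CompleteSpace E] (hC : IsInnerSelfDual C) {g : E →L[ℝ] E}
    (hg : MapsTo g C C) : MapsTo (g†) C C := fun x hx =>
  (hC _).2 fun y hy => by
    rw [ContinuousLinearMap.adjoint_inner_right]
    exact hC.inner_nonneg (hg hy) hx

/-- The automorphism group of a self-dual cone is stable under taking adjoints. -/
lemma adjoint_mem [CompleteSpace E] (hC : IsInnerSelfDual C) (hp : p ∈ autPairs C) :
    (p.1†, p.2†) ∈ autPairs C := by
  refine ⟨?_, ?_, adjoint_mapsTo hC hp.2.2.1, adjoint_mapsTo hC hp.2.2.2⟩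
  · simp only [← ContinuousLinearMap.star_eq_adjoint, ← star_mul, hp.2.1, star_one]
  · simp only [← ContinuousLinearMap.star_eq_adjoint, ← star_mul, hp.1, star_one]

/-- A cone-preserving operator is bounded by its value at any interior point. -/
lemma norm_le_of_mapsTo (hC : IsInnerSelfDual C) {g : E →L[ℝ] E} (hg : MapsTo g C C) {w : E}
    {r : ℝ} (hr : 0 < r) (hw : Metric.closedBall w r ⊆ C) : ‖g‖ ≤ ‖g w‖ / r := by
  refine ContinuousLinearMap.opNorm_le_bound _ (by positivity) fun x => ?_
  rcases eq_or_ne x 0 with rfl | hx0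
  · simp
  have hn : 0 < ‖x‖ := norm_pos_iff.2 hx0
  have hz : ‖(r / ‖x‖) • x‖ = r := by
    rw [norm_smul, Real.norm_eq_abs, abs_of_nonneg (by positivity), div_mul_cancel₀ _ hn.ne']
  have h1 := hg (hw (show w + (r / ‖x‖) • x ∈ _ by simp [hz]))
  have h2 := hg (hw (show w - (r / ‖x‖) • x ∈ _ by simp [hz]))
  rw [map_add] at h1
  rw [map_sub] at h2
  have h3 := hC.norm_le_of_add_mem_of_sub_mem h1 h2
  rw [map_smul, norm_smul, Real.norm_eq_abs, abs_of_nonneg (by positivity), div_mul_eq_mul_div,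
    div_le_iff₀ hn] at h3
  rw [div_mul_eq_mul_div, le_div_iff₀ hr]
  linarith

lemma norm_le_of_map_eq (hC : IsInnerSelfDual C) {p : (E →L[ℝ] E) × (E →L[ℝ] E)}
    (hp : p ∈ autPairs C) {e x : E} {r : ℝ} (hr : 0 < r) (he : Metric.closedBall e r ⊆ C)
    (hx : Metric.closedBall x r ⊆ C) (hpe : p.1 e = x) : ‖p‖ ≤ max (‖x‖ / r) (‖e‖ / r) := by
  have h1 := norm_le_of_mapsTo hC hp.2.2.1 hr he
  have h2 := norm_le_of_mapsTo hC hp.2.2.2 hr hx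
  rw [hpe] at h1
  rw [← hpe, snd_fst hp] at h2
  exact max_le_max h1 h2

lemma isCompact_inter [FiniteDimensional ℝ E] (hC : IsInnerSelfDual C)
    {K : Set ((E →L[ℝ] E) × (E →L[ℝ] E))} (hK : IsClosed K) {M : ℝ}
    (hM : ∀ p ∈ autPairs C ∩ K, ‖p‖ ≤ M) : IsCompact (autPairs C ∩ K) := by
  have : ProperSpace (E →L[ℝ] E) := FiniteDimensional.proper ℝ _
  refine (isCompact_closedBall 0 M).of_isClosed_subset ((isClosed hC).inter hK) fun p hp => ?_
  simpa using hM p hp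

end autPairs

/-! ### Its Lie algebra -/

/-- The Lie algebra of the automorphism group of a self-dual cone `C`, described infinitesimally:
at every boundary point the vector field `X` is tangent to every supporting hyperplane. In this form
it is visibly a linear subspace. -/
def tangentOps (C : Set E) : Submodule ℝ (E →L[ℝ] E) where
  carrier := {X | ∀ x ∈ C, ∀ y ∈ C, ⟪y, x⟫ = 0 → ⟪y, X x⟫ = 0}
  add_mem' := by
    intro X Y hX hY x hx y hy hxy
    rw [_root_.add_apply, inner_add_right, hX x hx y hy hxy, hY x hx y hy hxy, add_zero]
  zero_mem' := by
    intro x _ y _ _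
    simp
  smul_mem' := by
    intro a X hX x hx y hy hxy
    rw [_root_.smul_apply, inner_smul_right, hX x hx y hy hxy, mul_zero]

namespace tangentOps

variable {C : Set E} {X : E →L[ℝ] E}

lemma crossPositive (hX : X ∈ tangentOps C) : CrossPositive C X :=
  fun x hx y hy hxy => (hX x hx y hy hxy).ge

lemma adjoint_mem [CompleteSpace E] (hX : X ∈ tangentOps C) : X† ∈ tangentOps C := by
  intro x hx y hy hxy
  rw [ContinuousLinearMap.adjoint_inner_right, real_inner_comm]
  exact hX y hy x hx (by rwa [real_inner_comm])

/-- A limit of difference quotients of automorphisms tending to the identity lies in the Lie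
algebra. -/
lemma mem_of_tendsto {p : ℕ → (E →L[ℝ] E) × (E →L[ℝ] E)} (hC : IsInnerSelfDual C)
    (hp : ∀ j, p j ∈ autPairs C) (hp2 : Tendsto (fun j => (p j).2) atTop (𝓝 1)) {σ : ℕ → ℝ}
    (hσ : ∀ j, 0 < σ j) (hX : Tendsto (fun j => (σ j)⁻¹ • ((p j).1 - 1)) atTop (𝓝 X)) :
    X ∈ tangentOps C := by
  intro x hx y hy hxy
  apply le_antisymm
  · -- the inverses have the difference quotients `-g⁻¹ (g - 1) / σ`, which tend to `-X`
    have hlim : Tendsto (fun j => ⟪y, ((p j).2 * ((σ j)⁻¹ • ((p j).1 - 1))) x⟫) atTop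
        (𝓝 ⟪y, X x⟫) := by
      have h1 := hp2.mul hX
      rw [one_mul] at h1
      exact tendsto_const_nhds.inner
        (((ContinuousLinearMap.apply ℝ E x).continuous.tendsto _).comp h1)
    refine le_of_tendsto hlim (Eventually.of_forall fun j => ?_)
    have h2 : ((p j).2 * ((σ j)⁻¹ • ((p j).1 - 1))) x = (σ j)⁻¹ • (x - (p j).2 x) := by
      simp [map_sub, autPairs.snd_fst (hp j)]
    rw [h2, inner_smul_right, inner_sub_right, hxy]
    exact mul_nonpos_of_nonneg_of_nonpos (inv_nonneg.2 (hσ j).le)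
      (by linarith [hC.inner_nonneg hy ((hp j).2.2.2 hx)])
  · have hlim : Tendsto (fun j => ⟪y, ((σ j)⁻¹ • ((p j).1 - 1)) x⟫) atTop (𝓝 ⟪y, X x⟫) :=
      tendsto_const_nhds.inner (((ContinuousLinearMap.apply ℝ E x).continuous.tendsto _).comp hX)
    refine ge_of_tendsto hlim (Eventually.of_forall fun j => ?_)
    rw [_root_.smul_apply, _root_.sub_apply, one_apply_eq_self, inner_smul_right, inner_sub_right,
      hxy, sub_zero]
    exact mul_nonneg (inv_nonneg.2 (hσ j).le) (hC.inner_nonneg hy ((hp j).2.2.1 hx))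

variable [FiniteDimensional ℝ E]

lemma exp_mem (hC : IsInnerSelfDual C) (hne : (interior C).Nonempty) (hX : X ∈ tangentOps C) :
    (NormedSpace.exp X, NormedSpace.exp (-X)) ∈ autPairs C := by
  refine ⟨exp_mul_exp_neg X, ?_, fun x hx => (crossPositive hX).exp_mem hC hne hx,
    fun x hx => (crossPositive ((tangentOps C).neg_mem hX)).exp_mem hC hne hx⟩
  simpa using exp_mul_exp_neg (-X)

end tangentOps

lemma exp_smul_apply_eq_self [CompleteSpace E] {X : E →L[ℝ] E} {e : E} (hX : X e = 0) (s : ℝ) :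
    NormedSpace.exp (s • X) e = e := by
  have hd : ∀ t : ℝ, HasDerivAt (fun s : ℝ => NormedSpace.exp (s • X) e) 0 t := by
    intro t
    have h := (hasDerivAt_exp_smul_const (𝕂 := ℝ) X t).clm_apply (hasDerivAt_const t e)
    simpa [hX] using h
  have := is_const_of_deriv_eq_zero (fun t => (hd t).differentiableAt) (fun t => (hd t).deriv) s 0
  simpa [NormedSpace.exp_zero] using this

/-! ### A point fixed by all isometric automorphisms -/

variable [FiniteDimensional ℝ E] {C : Set E}

/-- The point of smallest norm among the centres of unit balls contained in the cone is fixed by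
every isometric automorphism of the cone. -/
theorem exists_fixed_of_isometry (hC : IsInnerSelfDual C) (hne : (interior C).Nonempty) :
    ∃ e ∈ interior C, ∀ p ∈ autPairs C, (∀ x, ‖p.1 x‖ = ‖x‖) → p.1 e = e := by
  set D : Set E := {x | Metric.closedBall x 1 ⊆ C} with hD
  have hDinter : D = ⋂ u ∈ Metric.closedBall (0 : E) 1, {x | x + u ∈ C} := by
    ext x
    simp only [hD, mem_iInter, mem_ofPred_eq]
    constructor
    · intro h u hu
      exact h (by simpa [mem_closedBall_iff_norm] using hu)
    · intro h z hz
      have := h (z - x) (by simpa [dist_eq_norm] using hz)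
      rwa [add_sub_cancel] at this
  have hDcl : IsClosed D := by
    rw [hDinter]
    exact isClosed_biInter fun u _ => hC.isClosed.preimage (by fun_prop)
  have hDconv : Convex ℝ D := by
    rw [hDinter]
    refine convex_iInter₂ fun u _ x hx y hy a b ha hb hab => ?_
    have h : a • x + b • y + u = a • (x + u) + b • (y + u) := by
      rw [smul_add, smul_add, add_add_add_comm, ← add_smul, hab, one_smul]
    rw [mem_ofPred_eq, h]
    exact hC.add_mem (hC.smul_mem hx ha) (hC.smul_mem hy hb)
  have hDne : D.Nonempty := by
    obtain ⟨c, hc⟩ := hne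
    obtain ⟨r, hr, hb⟩ := Metric.nhds_basis_closedBall.mem_iff.1 (mem_interior_iff_mem_nhds.1 hc)
    refine ⟨r⁻¹ • c, fun z hz => ?_⟩
    have h : r • z ∈ C := by
      apply hb
      rw [mem_closedBall_iff_norm] at hz ⊢
      have : r • z - c = r • (z - r⁻¹ • c) := by
        rw [smul_sub, smul_smul, mul_inv_cancel₀ hr.ne', one_smul]
      rw [this, norm_smul, Real.norm_eq_abs, abs_of_pos hr]
      nlinarith
    have h' := hC.smul_mem h (inv_nonneg.2 hr.le)
    rwa [smul_smul, inv_mul_cancel₀ hr.ne', one_smul] at h'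
  obtain ⟨e, heD, hemin⟩ := exists_norm_eq_iInf_of_complete_convex hDne hDcl.isComplete hDconv 0
  rw [norm_eq_iInf_iff_real_inner_le_zero hDconv heD] at hemin
  refine ⟨e, mem_interior_iff_mem_nhds.2 (mem_of_superset (Metric.closedBall_mem_nhds e one_pos)
    heD), fun p hp hiso => ?_⟩
  have hpe : p.1 e ∈ D := by
    intro u hu
    rw [mem_closedBall_iff_norm] at hu
    rw [← autPairs.fst_snd hp u]
    apply hp.2.2.1
    apply heD
    rwa [mem_closedBall_iff_norm, ← hiso, map_sub, autPairs.fst_snd hp]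
  have h := hemin _ hpe
  rw [zero_sub, inner_neg_left, inner_sub_right, real_inner_self_eq_norm_sq] at h
  have h2 := norm_sub_sq_real (p.1 e) e
  rw [hiso, real_inner_comm] at h2
  have h3 : ‖p.1 e - e‖ ^ 2 ≤ 0 := by linarith
  have h4 : ‖p.1 e - e‖ = 0 := by
    exact pow_eq_zero_iff two_ne_zero |>.1 (le_antisymm h3 (sq_nonneg _))
  exact sub_eq_zero.1 (norm_eq_zero.1 h4)

/-- At such a point the skew part of every element of the Lie algebra vanishes. -/
lemma adjoint_apply_of_fixed (hC : IsInnerSelfDual C) (hne : (interior C).Nonempty) {e : E}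
    (he : ∀ p ∈ autPairs C, (∀ x, ‖p.1 x‖ = ‖x‖) → p.1 e = e) {X : E →L[ℝ] E}
    (hX : X ∈ tangentOps C) : (X†) e = X e := by
  set Y := X - X† with hY
  have hYmem : Y ∈ tangentOps C := (tangentOps C).sub_mem hX (tangentOps.adjoint_mem hX)
  have hYskew : Y† = -Y := by
    simp [hY]
  have hfix : ∀ s : ℝ, NormedSpace.exp (s • Y) e = e := by
    intro s
    have hmem := tangentOps.exp_mem hC hne ((tangentOps C).smul_mem s hYmem)
    refine he _ hmem fun x => ?_
    have hadj : (NormedSpace.exp (s • Y))† = NormedSpace.exp (-(s • Y)) := by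
      rw [← ContinuousLinearMap.star_eq_adjoint, NormedSpace.star_exp,
        ContinuousLinearMap.star_eq_adjoint, map_smulₛₗ, hYskew]
      simp
    have h1 : ‖NormedSpace.exp (s • Y) x‖ ^ 2 = ‖x‖ ^ 2 := by
      rw [← real_inner_self_eq_norm_sq, ← ContinuousLinearMap.adjoint_inner_left, hadj,
        autPairs.snd_fst hmem, real_inner_self_eq_norm_sq]
    exact (sq_eq_sq₀ (norm_nonneg _) (norm_nonneg _)).1 h1
  have hd := hasDerivAt_exp_smul_apply Y e 0
  simp only [hfix] at hd
  have h0 := hd.unique (hasDerivAt_const (0 : ℝ) e)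
  rw [hY, _root_.sub_apply, sub_eq_zero] at h0
  exact h0.symm

end

section

variable {E : Type*} [NormedAddCommGroup E] [InnerProductSpace ℝ E] [FiniteDimensional ℝ E]
  {C : Set E}

/-! ### Infinitesimal transitivity and scaling -/

/-- If the automorphism group is transitive on the interior of the cone, then the automorphisms that
move an interior point `e` to `e + t d` and are as close to the identity as possible tend to the
identity along some sequence `t → 0`. -/
lemma exists_closest_autPairs (hC : IsInnerSelfDual C)
    (htrans : ∀ x ∈ interior C, ∀ y ∈ interior C, ∃ p ∈ autPairs C, p.1 x = y) {e : E}
    (he : e ∈ interior C) (d : E) :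
    ∃ (t : ℕ → ℝ) (m : ℕ → (E →L[ℝ] E) × (E →L[ℝ] E)), (∀ j, 0 < t j) ∧
      Tendsto t atTop (𝓝 0) ∧ (∀ j, m j ∈ autPairs C) ∧ (∀ j, (m j).1 e = e + t j • d) ∧
      (∀ j, ∀ q ∈ autPairs C, q.1 e = e + t j • d → ‖(m j).1 - 1‖ ≤ ‖q.1 - 1‖) ∧
      Tendsto m atTop (𝓝 (1, 1)) := by
  obtain ⟨R, hR, hbR⟩ := Metric.nhds_basis_closedBall.mem_iff.1 (mem_interior_iff_mem_nhds.1 he)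
  -- half the radius is kept as room for the displacements `t j • d`
  set r := R / 2 with hr_def
  have hr : 0 < r := by positivity
  set t : ℕ → ℝ := fun j => r / (‖d‖ + 1) / (j + 1) with ht_def
  have ht : ∀ j, 0 < t j := fun j => by positivity
  have ht0 : Tendsto t atTop (𝓝 0) := by
    have := (tendsto_one_div_add_atTop_nhds_zero_nat (𝕜 := ℝ)).const_mul (r / (‖d‖ + 1))
    simpa [ht_def, div_eq_mul_inv] using this
  set x : ℕ → E := fun j => e + t j • d with hx_def
  have htd : ∀ j, ‖t j • d‖ ≤ r := by
    intro j
    rw [norm_smul, Real.norm_eq_abs, abs_of_pos (ht j)]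
    have h1 : t j ≤ r / (‖d‖ + 1) := div_le_self (by positivity) (by
      have : (0 : ℝ) ≤ j := j.cast_nonneg
      linarith)
    calc t j * ‖d‖ ≤ r / (‖d‖ + 1) * (‖d‖ + 1) := by gcongr; linarith
      _ = r := div_mul_cancel₀ _ (by positivity)
  have hbx : ∀ j, Metric.closedBall (x j) r ⊆ C := fun j =>
    (Metric.closedBall_subset_closedBall' (by
      simpa [hx_def, hr_def] using by linarith [htd j])).trans hbR
  have hbe : Metric.closedBall e r ⊆ C :=
    (Metric.closedBall_subset_closedBall (by linarith)).trans hbR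
  have hxn : ∀ j, ‖x j‖ ≤ ‖e‖ + r := fun j => (norm_add_le _ _).trans (by linarith [htd j])
  have hxint : ∀ j, x j ∈ interior C := fun j =>
    mem_interior_iff_mem_nhds.2 (mem_of_superset (Metric.closedBall_mem_nhds _ hr) (hbx j))
  set M : ℝ := (‖e‖ + r) / r with hM
  have hbound : ∀ j, ∀ p ∈ autPairs C ∩ {p | p.1 e = x j}, ‖p‖ ≤ M := by
    intro j p hp
    refine (autPairs.norm_le_of_map_eq hC hp.1 hr hbe (hbx j) hp.2).trans (max_le ?_ ?_)
    · exact div_le_div_of_nonneg_right (hxn j) hr.le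
    · exact div_le_div_of_nonneg_right (by linarith) hr.le
  have hmin : ∀ j, ∃ p ∈ autPairs C, p.1 e = x j ∧
      ∀ q ∈ autPairs C, q.1 e = x j → ‖p.1 - 1‖ ≤ ‖q.1 - 1‖ := by
    intro j
    obtain ⟨p, hp, hpx⟩ := htrans e he (x j) (hxint j)
    obtain ⟨p, hp, hpmin⟩ := (autPairs.isCompact_inter hC
      (isClosed_eq (by fun_prop) continuous_const) (hbound j)).exists_isMinOn ⟨p, hp, hpx⟩
      (f := fun p : (E →L[ℝ] E) × (E →L[ℝ] E) => ‖p.1 - 1‖)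
      (continuous_fst.sub continuous_const).norm.continuousOn
    exact ⟨p, hp.1, hp.2, fun q hq hqx => hpmin ⟨hq, hqx⟩⟩
  choose m hmem hmx hmmin using hmin
  have : ProperSpace (E →L[ℝ] E) := FiniteDimensional.proper ℝ _
  have hcpt := isCompact_closedBall (0 : (E →L[ℝ] E) × (E →L[ℝ] E)) M
  obtain ⟨k, -, φ, hφ, hk⟩ := hcpt.tendsto_subseq (x := m) fun j => by
    simpa using hbound j _ ⟨hmem j, hmx j⟩
  have hk : Tendsto (fun j => m (φ j)) atTop (𝓝 k) := hk
  have htφ : Tendsto (fun j => t (φ j)) atTop (𝓝 0) := ht0.comp hφ.tendsto_atTop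
  have hkmem : k ∈ autPairs C :=
    (autPairs.isClosed hC).mem_of_tendsto hk (Eventually.of_forall fun j => hmem _)
  have hke : k.1 e = e := by
    have h1 : Tendsto (fun j => (m (φ j)).1 e) atTop (𝓝 (k.1 e)) :=
      ((ContinuousLinearMap.apply ℝ E e).continuous.tendsto _).comp hk.fst_nhds
    have h2 : Tendsto (fun j => (m (φ j)).1 e) atTop (𝓝 (e + (0 : ℝ) • d)) := by
      have : (fun j => (m (φ j)).1 e) = fun j => e + t (φ j) • d := funext fun j => hmx _
      rw [this]
      exact tendsto_const_nhds.add (htφ.smul_const d)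
    rw [zero_smul, add_zero] at h2
    exact tendsto_nhds_unique h1 h2
  have hk'e : k.2 e = e := by
    conv_lhs => rw [← hke]
    exact autPairs.snd_fst hkmem e
  -- composing with the inverse of the limit shows that the closest automorphisms tend to `1`
  have hm1 : Tendsto (fun j => ‖(m (φ j)).1 - 1‖) atTop (𝓝 0) := by
    have hup : Tendsto (fun j => ‖(m (φ j)).1 * k.2 - 1‖) atTop (𝓝 0) := by
      have := ((hk.fst_nhds.mul_const k.2).sub_const 1).norm
      rwa [hkmem.1, sub_self, norm_zero] at this
    refine squeeze_zero (fun j => norm_nonneg _) (fun j => ?_) hup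
    have hq := autPairs.mul_mem (hmem (φ j)) (autPairs.swap_mem hkmem)
    have hqe : ((m (φ j)).1 * k.2) e = x (φ j) := by rw [mul_apply_eq_comp, hk'e, hmx]
    have := hmmin (φ j) _ hq hqe
    exact this
  have hk1 : k.1 = 1 := tendsto_nhds_unique hk.fst_nhds (tendsto_iff_norm_sub_tendsto_zero.2 hm1)
  have hk2 : k.2 = 1 := by
    have := hkmem.1
    rwa [hk1, one_mul] at this
  have hk11 : k = (1, 1) := Prod.ext hk1 hk2
  exact ⟨fun j => t (φ j), fun j => m (φ j), fun j => ht _, htφ, fun j => hmem _, fun j => hmx _,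
    fun j => hmmin _, hk11 ▸ hk⟩

/-- If the automorphism group is transitive on the interior of the cone, then its Lie algebra is
transitive on tangent vectors. The automorphism moving `e` to `e + t d` is chosen as close to the
identity as possible; its distance to the identity is then of order `t`, since otherwise a limit of
difference quotients would be an element `X` of the Lie algebra with `X e = 0`, and composing with
`exp (-σ X)` would bring the automorphism still closer to the identity. -/
theorem exists_tangentOps_apply_eq (hC : IsInnerSelfDual C)
    (htrans : ∀ x ∈ interior C, ∀ y ∈ interior C, ∃ p ∈ autPairs C, p.1 x = y) {e : E}
    (he : e ∈ interior C) (d : E) : ∃ X ∈ tangentOps C, X e = d := by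
  obtain ⟨t, m, ht, ht0, hmem, hmx, hmmin, hm1⟩ := exists_closest_autPairs hC htrans he d
  -- the summand `t j` keeps `σ j` positive and lets both cases below share one subsequence
  set σ : ℕ → ℝ := fun j => t j + ‖(m j).1 - 1‖ with hσ_def
  have hσ : ∀ j, 0 < σ j := fun j => add_pos_of_pos_of_nonneg (ht j) (norm_nonneg _)
  set Y : ℕ → (E →L[ℝ] E) := fun j => (σ j)⁻¹ • ((m j).1 - 1) with hY_def
  set τ : ℕ → ℝ := fun j => (σ j)⁻¹ * t j with hτ_def
  have hYn : ∀ j, ‖Y j‖ = (σ j)⁻¹ * ‖(m j).1 - 1‖ := fun j => by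
    rw [hY_def, norm_smul, Real.norm_eq_abs, abs_of_pos (inv_pos.2 (hσ j))]
  have hsum : ∀ j, τ j + ‖Y j‖ = 1 := fun j => by
    rw [hYn, hτ_def, ← mul_add, inv_mul_cancel₀ (hσ j).ne']
  have hτ0 : ∀ j, 0 ≤ τ j := fun j => mul_nonneg (inv_nonneg.2 (hσ j).le) (ht j).le
  -- extract a convergent subsequence of the difference quotients
  have : ProperSpace (E →L[ℝ] E) := FiniteDimensional.proper ℝ _
  have hcpt : IsCompact (Metric.closedBall (0 : E →L[ℝ] E) 1 ×ˢ Icc (0 : ℝ) 1) :=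
    (isCompact_closedBall _ _).prod isCompact_Icc
  obtain ⟨⟨X, τ'⟩, -, φ, hφ, hlim⟩ := hcpt.tendsto_subseq (x := fun j => (Y j, τ j))
    fun j => ⟨by simpa using (by linarith [hsum j, hτ0 j] : ‖Y j‖ ≤ 1),
      hτ0 j, by linarith [hsum j, norm_nonneg (Y j)]⟩
  have hX : Tendsto (fun j => Y (φ j)) atTop (𝓝 X) := hlim.fst_nhds
  have hτlim : Tendsto (fun j => τ (φ j)) atTop (𝓝 τ') := hlim.snd_nhds
  have hmone : Tendsto (fun j => (m (φ j)).1) atTop (𝓝 1) :=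
    hm1.fst_nhds.comp hφ.tendsto_atTop
  have hσφ : Tendsto (fun j => σ (φ j)) atTop (𝓝 0) := by
    simpa using (ht0.comp hφ.tendsto_atTop).add (hmone.sub_const 1).norm
  have hXmem : X ∈ tangentOps C :=
    tangentOps.mem_of_tendsto hC (p := fun j => m (φ j)) (fun j => hmem _)
      (hm1.snd_nhds.comp hφ.tendsto_atTop) (fun j => hσ (φ j)) hX
  have hXe : X e = τ' • d := by
    have h1 : Tendsto (fun j => Y (φ j) e) atTop (𝓝 (X e)) :=
      ((ContinuousLinearMap.apply ℝ E e).continuous.tendsto _).comp hX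
    have h2 : (fun j => Y (φ j) e) = fun j => τ (φ j) • d := by
      funext j
      have h3 : (m (φ j)).1 e = e + t (φ j) • d := hmx _
      simp only [hY_def, hτ_def, _root_.smul_apply, _root_.sub_apply, one_apply_eq_self, h3,
        add_sub_cancel_left, smul_smul]
    rw [h2] at h1
    exact tendsto_nhds_unique h1 (hτlim.smul_const d)
  rcases eq_or_ne τ' 0 with hτ'0 | hτ'0
  swap
  · exact ⟨τ'⁻¹ • X, (tangentOps C).smul_mem _ hXmem, by
      rw [_root_.smul_apply, hXe, smul_smul, inv_mul_cancel₀ hτ'0, one_smul]⟩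
  -- in the degenerate case `X` is a unit vector of the Lie algebra of the stabilizer of `e`
  exfalso
  rw [hτ'0, zero_smul] at hXe
  have hXn : ‖X‖ = 1 := by
    have h1 := hτlim.add hX.norm
    simp only [hsum, hτ'0, zero_add] at h1
    exact (tendsto_nhds_unique h1 tendsto_const_nhds)
  have hne : (interior C).Nonempty := ⟨e, he⟩
  have hXe' : (-X) e = 0 := by simp [hXe]
  have hder : Tendsto (fun j => (σ (φ j))⁻¹ • (NormedSpace.exp (σ (φ j) • (-X)) - 1)) atTop
      (𝓝 (-X)) := by
    have h1 := (hasDerivAt_exp_smul_const (𝕂 := ℝ) (-X) 0).tendsto_slope_zero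
    simp only [zero_add, zero_smul, NormedSpace.exp_zero, one_mul] at h1
    refine h1.comp (tendsto_nhdsWithin_iff.2 ⟨hσφ, Eventually.of_forall fun j => ?_⟩)
    exact (hσ (φ j)).ne'
  have hcloser : Tendsto (fun j => ‖Y (φ j) + (m (φ j)).1 *
      ((σ (φ j))⁻¹ • (NormedSpace.exp (σ (φ j) • (-X)) - 1))‖) atTop (𝓝 0) := by
    have := (hX.add (hmone.mul hder)).norm
    rwa [one_mul, add_neg_cancel, norm_zero] at this
  have hle : ∀ j, ‖Y (φ j)‖ ≤ ‖Y (φ j) + (m (φ j)).1 *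
      ((σ (φ j))⁻¹ • (NormedSpace.exp (σ (φ j) • (-X)) - 1))‖ := by
    intro j
    have hq := autPairs.mul_mem (hmem (φ j)) (tangentOps.exp_mem hC hne
      ((tangentOps C).smul_mem (σ (φ j)) ((tangentOps C).neg_mem hXmem)))
    have h1 : ‖(m (φ j)).1 - 1‖ ≤ ‖(m (φ j)).1 * NormedSpace.exp (σ (φ j) • (-X)) - 1‖ := by
      have hqe : ((m (φ j)).1 * NormedSpace.exp (σ (φ j) • (-X))) e = e + t (φ j) • d := by
        rw [mul_apply_eq_comp, exp_smul_apply_eq_self hXe', hmx]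
      have := hmmin (φ j) _ hq hqe
      exact this
    have h2 : Y (φ j) + (m (φ j)).1 * ((σ (φ j))⁻¹ • (NormedSpace.exp (σ (φ j) • (-X)) - 1)) =
        (σ (φ j))⁻¹ • ((m (φ j)).1 * NormedSpace.exp (σ (φ j) • (-X)) - 1) := by
      simp only [hY_def]
      rw [mul_smul_comm, ← smul_add, mul_sub, mul_one, sub_add_sub_cancel']
    rw [h2, hYn, norm_smul, Real.norm_eq_abs, abs_of_pos (inv_pos.2 (hσ _))]
    exact mul_le_mul_of_nonneg_left h1 (inv_nonneg.2 (hσ _).le)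
  have h0 : ‖X‖ ≤ 0 := le_of_tendsto_of_tendsto hX.norm hcloser (Eventually.of_forall hle)
  linarith

/-- Scaling: any interior point `x₀` of a homogeneous self-dual cone is mapped to any other interior
point `y₀` by an operator of the form `R† R` with `R` an automorphism. With `e` the point fixed by
all isometric automorphisms, the automorphism `g = R⁻¹` is found by minimizing
`⟪y₀, g e⟫ + ⟪g⁻¹ x₀, e⟫`: stationarity says that `g† y₀ - g⁻¹ x₀` is orthogonal to `X e` for every
`X` in the Lie algebra. -/
theorem exists_adjoint_apply_apply_eq (hC : IsInnerSelfDual C)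
    (htrans : ∀ x ∈ interior C, ∀ y ∈ interior C, ∃ p ∈ autPairs C, p.1 x = y) {x₀ y₀ : E}
    (hx₀ : x₀ ∈ interior C) (hy₀ : y₀ ∈ interior C) :
    ∃ p ∈ autPairs C, (p.1†) (p.1 x₀) = y₀ := by
  have hne : (interior C).Nonempty := ⟨x₀, hx₀⟩
  obtain ⟨e, he, hfix⟩ := exists_fixed_of_isometry hC hne
  obtain ⟨r₁, hr₁, hb₁⟩ := Metric.nhds_basis_closedBall.mem_iff.1 (mem_interior_iff_mem_nhds.1 he)
  obtain ⟨r₂, hr₂, hb₂⟩ := Metric.nhds_basis_closedBall.mem_iff.1 (mem_interior_iff_mem_nhds.1 hx₀)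
  obtain ⟨r₃, hr₃, hb₃⟩ := Metric.nhds_basis_closedBall.mem_iff.1 (mem_interior_iff_mem_nhds.1 hy₀)
  set f : (E →L[ℝ] E) × (E →L[ℝ] E) → ℝ := fun p => ⟪y₀, p.1 e⟫ + ⟪e, p.2 x₀⟫ with hf
  have hfc : Continuous f := by fun_prop
  set M := f (1, 1) with hM
  have hbound : ∀ p ∈ autPairs C ∩ {p | f p ≤ M}, ‖p‖ ≤ max (M / r₃ / r₁) (M / r₁ / r₂) := by
    rintro p ⟨hp, hpM⟩
    have hpM' : ⟪y₀, p.1 e⟫ + ⟪e, p.2 x₀⟫ ≤ M := hpM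
    have hpe := hp.2.2.1 (interior_subset he)
    have hpx := hp.2.2.2 (interior_subset hx₀)
    have h1 := hC.mul_norm_le_inner hr₃.le hb₃ hpe
    have h2 := hC.mul_norm_le_inner hr₁.le hb₁ hpx
    have h3 : 0 ≤ r₃ * ‖p.1 e‖ := by positivity
    have h4 : 0 ≤ r₁ * ‖p.2 x₀‖ := by positivity
    refine max_le_max ((autPairs.norm_le_of_mapsTo hC hp.2.2.1 hr₁ hb₁).trans ?_)
      ((autPairs.norm_le_of_mapsTo hC hp.2.2.2 hr₂ hb₂).trans ?_)
    · refine div_le_div_of_nonneg_right ?_ hr₁.le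
      rw [le_div_iff₀ hr₃]
      linarith
    · refine div_le_div_of_nonneg_right ?_ hr₂.le
      rw [le_div_iff₀ hr₁]
      linarith
  obtain ⟨p, ⟨hp, hpM⟩, hpmin⟩ := (autPairs.isCompact_inter hC
    (isClosed_le hfc continuous_const) hbound).exists_isMinOn ⟨(1, 1), autPairs.one_mem, hM.ge⟩
    hfc.continuousOn
  have hmin : ∀ q ∈ autPairs C, f p ≤ f q := by
    intro q hq
    by_cases hqM : f q ≤ M
    · exact hpmin ⟨hq, hqM⟩
    · exact le_trans hpM (not_le.1 hqM).le
  obtain ⟨X, hX, hXe⟩ := exists_tangentOps_apply_eq hC htrans he ((p.1†) y₀ - p.2 x₀)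
  have hcrit : ⟪y₀, p.1 (X e)⟫ + ⟪e, (-X) (p.2 x₀)⟫ = 0 := by
    have hd : HasDerivAt (fun s : ℝ => f (p.1 * NormedSpace.exp (s • X),
        NormedSpace.exp (s • (-X)) * p.2)) (⟪y₀, p.1 (X e)⟫ + ⟪e, (-X) (p.2 x₀)⟫) 0 := by
      have h1 := p.1.hasFDerivAt.comp_hasDerivAt (0 : ℝ) (hasDerivAt_exp_smul_apply X e 0)
      have h2 := hasDerivAt_exp_smul_apply (-X) (p.2 x₀) 0
      have h3 := ((hasDerivAt_const (0 : ℝ) y₀).inner ℝ h1).fun_add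
        ((hasDerivAt_const (0 : ℝ) e).inner ℝ h2)
      simp only [zero_smul, NormedSpace.exp_zero, one_apply_eq_self, inner_zero_left,
        add_zero] at h3
      exact h3
    refine IsLocalMin.hasDerivAt_eq_zero (Eventually.of_forall fun s => ?_) hd
    have h4 : f (p.1 * NormedSpace.exp ((0 : ℝ) • X), NormedSpace.exp ((0 : ℝ) • (-X)) * p.2) =
        f p := by
      simp [hf, NormedSpace.exp_zero]
    rw [h4]
    have h5 := autPairs.mul_mem hp (tangentOps.exp_mem hC hne ((tangentOps C).smul_mem s hX))
    rw [← smul_neg] at h5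
    exact hmin _ h5
  have heq : (p.1†) y₀ = p.2 x₀ := by
    have h6 : ⟪y₀, p.1 (X e)⟫ = ⟪(p.1†) y₀, X e⟫ :=
      (ContinuousLinearMap.adjoint_inner_left p.1 (X e) y₀).symm
    have h7 : ⟪e, X (p.2 x₀)⟫ = ⟪p.2 x₀, X e⟫ := by
      rw [← ContinuousLinearMap.adjoint_inner_left, adjoint_apply_of_fixed hC hne hfix hX,
        real_inner_comm]
    rw [h6, _root_.neg_apply, inner_neg_right, h7, ← sub_eq_add_neg, ← inner_sub_left,
      hXe] at hcrit
    exact sub_eq_zero.1 (inner_self_eq_zero.1 hcrit)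
  refine ⟨_, autPairs.swap_mem hp, ?_⟩
  change (p.2†) (p.2 x₀) = y₀
  rw [← heq]
  exact autPairs.snd_fst (autPairs.adjoint_mem hC hp) y₀

end

/-! ### Lyapunov functions for cross-positive operators -/

section Operators

variable {E : Type*} [NormedAddCommGroup E] [InnerProductSpace ℝ E] {C : Set E}

lemma exp_zero_smul_apply (A : E →L[ℝ] E) (x : E) : NormedSpace.exp ((0 : ℝ) • A) x = x := by
  rw [zero_smul, NormedSpace.exp_zero, one_apply_eq_self]

/-- Operators whose flow preserves the cone are cross-positive. -/
lemma CrossPositive.of_exp_mem [CompleteSpace E] (hC : IsInnerSelfDual C) {A : E →L[ℝ] E}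
    (h : ∀ t : ℝ, 0 ≤ t → ∀ x ∈ C, NormedSpace.exp (t • A) x ∈ C) : CrossPositive C A := by
  intro x hx y hy hxy
  have hd : HasDerivAt (fun s : ℝ => ⟪y, NormedSpace.exp (s • A) x⟫) ⟪y, A x⟫ 0 := by
    have := (hasDerivAt_const (0 : ℝ) y).inner ℝ (hasDerivAt_exp_smul_apply A x 0)
    simpa [NormedSpace.exp_zero] using this
  have hlim : Tendsto _ (𝓝[>] (0 : ℝ)) _ :=
    hd.tendsto_slope_zero.mono_left (nhdsWithin_mono _ fun s hs => ne_of_gt hs)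
  refine ge_of_tendsto hlim (eventually_nhdsWithin_of_forall fun s (hs : 0 < s) => ?_)
  simp only [zero_add, zero_smul, NormedSpace.exp_zero, one_apply_eq_self, hxy, sub_zero]
  exact mul_nonneg (inv_nonneg.2 hs.le) (hC.inner_nonneg hy (h s hs.le x hx))

lemma CrossPositive.conj [CompleteSpace E] (hC : IsInnerSelfDual C) {A : E →L[ℝ] E}
    (hA : CrossPositive C A) {p : (E →L[ℝ] E) × (E →L[ℝ] E)} (hp : p ∈ autPairs C) :
    CrossPositive C (p.1 * A * p.2) := by
  intro x hx y hy hxy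
  rw [mul_apply_eq_comp, mul_apply_eq_comp, ← ContinuousLinearMap.adjoint_inner_left]
  refine hA _ (hp.2.2.2 hx) _ (autPairs.adjoint_mapsTo hC hp.2.2.1 hy) ?_
  rw [ContinuousLinearMap.adjoint_inner_left, autPairs.fst_snd hp, hxy]

variable [FiniteDimensional ℝ E]

/-- A self-adjoint cross-positive operator pointing strictly into `-C` at some interior point of `C`
is negative definite. -/
lemma CrossPositive.inner_neg (hC : IsInnerSelfDual C) {B : E →L[ℝ] E} (hB : CrossPositive C B)
    (hsymm : IsSelfAdjoint B) {z : E} (hz : z ∈ interior C) (hBz : -B z ∈ interior C) {x : E}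
    (hx : x ≠ 0) : ⟪x, B x⟫ < 0 := by
  have hS : IsCompact (Metric.sphere (0 : E) ‖x‖) := isCompact_sphere 0 _
  obtain ⟨v, hv, hmax⟩ := hS.exists_isMaxOn ⟨x, by simp⟩
    B.reApplyInnerSelf_continuous.continuousOn
  have hvn : ‖v‖ = ‖x‖ := by simpa using hv
  have hv0 : v ≠ 0 := norm_ne_zero_iff.1 (by rw [hvn]; exact norm_ne_zero_iff.2 hx)
  rw [← hvn] at hmax
  have heig := hsymm.hasEigenvector_of_isMaxOn hv0 hmax
  have hBv := heig.apply_eq_smul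
  have hμ := hB.eigenvalue_neg hC hz hBz hv0 hBv
  have h1 : B.reApplyInnerSelf x ≤ B.reApplyInnerSelf v :=
    hmax (show x ∈ Metric.sphere (0 : E) ‖v‖ by simp [hvn])
  have h2 : B.reApplyInnerSelf v < 0 := by
    have : B v = _ := hBv
    rw [ContinuousLinearMap.reApplyInnerSelf_apply, this, inner_smul_left,
      real_inner_self_eq_norm_sq]
    simp only [conj_trivial, RCLike.re_to_real]
    exact mul_neg_of_neg_of_pos hμ (by positivity)
  rw [real_inner_comm]
  exact lt_of_le_of_lt h1 h2

/-- On a homogeneous self-dual cone, some automorphism `g` turns a cross-positive operator `A`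
without nonnegative real eigenvalues into an operator `g A g⁻¹` with negative definite symmetric
part. Taking interior points `x₀`, `y₀` which `A`, `A†` map into the interior of `-C`, any `g` with
`g† g x₀ = y₀` works, because both `g A g⁻¹` and its adjoint map `g x₀` into the interior of
`-C`. -/
theorem exists_autPairs_inner_neg (hC : IsInnerSelfDual C) (hne : (interior C).Nonempty)
    (htrans : ∀ x ∈ interior C, ∀ y ∈ interior C, ∃ p ∈ autPairs C, p.1 x = y) {A : E →L[ℝ] E}
    (hA : CrossPositive C A)
    (hres : ∀ s : ℝ, 0 ≤ s → IsUnit (s • (1 : E →L[ℝ] E) - A)) :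
    ∃ p ∈ autPairs C, ∀ x, x ≠ 0 → ⟪p.1 x, p.1 (A x)⟫ < 0 := by
  obtain ⟨c, hc⟩ := hne
  have hres' : ∀ s : ℝ, 0 ≤ s → IsUnit (s • (1 : E →L[ℝ] E) - A†) := by
    intro s hs
    have := (hres s hs).star
    rwa [star_sub, star_smul, star_one, star_trivial, ContinuousLinearMap.star_eq_adjoint] at this
  obtain ⟨x₀, hx₀, hAx₀⟩ := hA.exists_apply_eq_neg hC hres hc
  obtain ⟨y₀, hy₀, hAy₀⟩ := hA.adjoint.exists_apply_eq_neg hC hres' hc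
  obtain ⟨p, hp, hpxy⟩ := exists_adjoint_apply_apply_eq hC htrans hx₀ hy₀
  refine ⟨p, hp, fun x hx => ?_⟩
  set F := p.1 * A * p.2 with hF
  have hFcp := hA.conj hC hp
  have hadj : ∀ v, (F†) v = (p.2†) ((A†) ((p.1†) v)) := by
    intro v
    rw [hF, ← ContinuousLinearMap.star_eq_adjoint, star_mul, star_mul]
    rfl
  have hBz : -(F + F†) (p.1 x₀) ∈ interior C := by
    have h1 : F (p.1 x₀) = -p.1 c := by
      rw [hF, mul_apply_eq_comp, mul_apply_eq_comp, autPairs.snd_fst hp, hAx₀, map_neg]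
    have h2 : (F†) (p.1 x₀) = -(p.2†) c := by
      rw [hadj, hpxy, hAy₀, map_neg]
    rw [_root_.add_apply, h1, h2, ← neg_add, neg_neg]
    exact hC.interior_add_mem (autPairs.mapsTo_interior hp hc)
      (autPairs.adjoint_mapsTo hC hp.2.2.2 (interior_subset hc))
  have hpx : p.1 x ≠ 0 := by
    intro h0
    apply hx
    rw [← autPairs.snd_fst hp x, h0, map_zero]
  have hneg := (hFcp.add hFcp.adjoint).inner_neg hC (IsSelfAdjoint.add_star_self F)
    (autPairs.mapsTo_interior hp hx₀) hBz hpx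
  rw [_root_.add_apply, inner_add_right, ContinuousLinearMap.adjoint_inner_right,
    real_inner_comm (p.1 x) (F (p.1 x))] at hneg
  have h3 : F (p.1 x) = p.1 (A x) := by
    rw [hF, mul_apply_eq_comp, mul_apply_eq_comp, autPairs.snd_fst hp]
  rw [h3] at hneg
  linarith

end Operators

/-! ### Matrices acting on Euclidean space -/

section Matrices

variable {n : ℕ} {C : Set (Fin n → ℝ)}

/-- A subset of `Fin n → ℝ`, regarded as a subset of Euclidean space. -/
def euclideanSet (C : Set (Fin n → ℝ)) : Set (EuclideanSpace ℝ (Fin n)) :=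
  {x | WithLp.ofLp x ∈ C}

lemma inner_eq_dotProduct (x y : EuclideanSpace ℝ (Fin n)) :
    ⟪x, y⟫ = WithLp.ofLp x ⬝ᵥ WithLp.ofLp y := by
  rw [EuclideanSpace.inner_eq_star_dotProduct, dotProduct_comm]
  rfl

lemma IsSelfDual.isInnerSelfDual (hC : IsSelfDual C) : IsInnerSelfDual (euclideanSet C) := by
  intro x
  change WithLp.ofLp x ∈ C ↔ _
  conv_lhs => rw [← hC]
  constructor
  · intro h y hy
    rw [inner_eq_dotProduct, dotProduct_comm]
    exact h _ hy
  · intro h y hy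
    have := h (WithLp.toLp 2 y) hy
    rwa [inner_eq_dotProduct, dotProduct_comm] at this

lemma mem_interior_euclideanSet {x : EuclideanSpace ℝ (Fin n)} :
    x ∈ interior (euclideanSet C) ↔ WithLp.ofLp x ∈ interior C := by
  have := (PiLp.continuousLinearEquiv 2 ℝ (fun _ : Fin n => ℝ)).toHomeomorph.preimage_interior C
  change x ∈ interior ((PiLp.continuousLinearEquiv 2 ℝ (fun _ : Fin n => ℝ)).toHomeomorph ⁻¹' C) ↔ _
  rw [← this]
  rfl

/-- An element of `coneAut C` is invertible, because its range contains an open set. -/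
lemma coneAut.autPairs_mem (hne : (interior C).Nonempty) {L : Matrix (Fin n) (Fin n) ℝ}
    (hL : L ∈ coneAut C) :
    (toEuclideanCLM (𝕜 := ℝ) L, toEuclideanCLM (𝕜 := ℝ) L⁻¹) ∈ autPairs (euclideanSet C) := by
  have hL' : (fun x => L *ᵥ x) '' C = C := hL
  have hsub : C ⊆ (LinearMap.range L.mulVecLin : Set (Fin n → ℝ)) := by
    intro x hx
    rw [← hL'] at hx
    obtain ⟨y, -, rfl⟩ := hx
    exact ⟨y, rfl⟩
  have htop : LinearMap.range L.mulVecLin = ⊤ :=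
    Submodule.eq_top_of_nonempty_interior' _ (hne.mono (interior_mono hsub))
  have hunit : IsUnit L := mulVec_surjective_iff_isUnit.1 (LinearMap.range_eq_top.1 htop)
  have hdet := (isUnit_iff_isUnit_det L).1 hunit
  refine ⟨?_, ?_, ?_, ?_⟩
  · rw [← map_mul, mul_nonsing_inv _ hdet, map_one]
  · rw [← map_mul, nonsing_inv_mul _ hdet, map_one]
  · intro x hx
    change L *ᵥ _ ∈ C
    rw [← hL']
    exact ⟨_, hx, rfl⟩
  · intro x hx
    have hx' : WithLp.ofLp x ∈ C := hx
    rw [← hL'] at hx'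
    obtain ⟨y, hy, hyx⟩ := hx'
    have hgoal : L⁻¹ *ᵥ WithLp.ofLp x ∈ C := by
      rw [← hyx]
      simpa [mulVec_mulVec, nonsing_inv_mul _ hdet] using hy
    exact hgoal

lemma coneAut.mem_of_autPairs {p : (EuclideanSpace ℝ (Fin n) →L[ℝ] EuclideanSpace ℝ (Fin n)) ×
    (EuclideanSpace ℝ (Fin n) →L[ℝ] EuclideanSpace ℝ (Fin n))}
    (hp : p ∈ autPairs (euclideanSet C)) {L : Matrix (Fin n) (Fin n) ℝ}
    (hL : toEuclideanCLM (𝕜 := ℝ) L = p.1) : L ∈ coneAut C := by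
  have hmul : ∀ x : Fin n → ℝ, L *ᵥ x = WithLp.ofLp (p.1 (WithLp.toLp 2 x)) := by
    intro x
    rw [← hL]
    rfl
  apply Subset.antisymm
  · rintro _ ⟨x, hx, rfl⟩
    change L *ᵥ x ∈ C
    rw [hmul]
    exact hp.2.2.1 (show WithLp.toLp 2 x ∈ euclideanSet C from hx)
  · intro x hx
    refine ⟨WithLp.ofLp (p.2 (WithLp.toLp 2 x)),
      hp.2.2.2 (show WithLp.toLp 2 x ∈ euclideanSet C from hx), ?_⟩
    change L *ᵥ _ = x
    rw [hmul, WithLp.toLp_ofLp, autPairs.fst_snd hp]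

lemma invariantMatrices.crossPositive (hC : IsSelfDual C) {A : Matrix (Fin n) (Fin n) ℝ}
    (hA : A ∈ invariantMatrices C) :
    CrossPositive (euclideanSet C) (toEuclideanCLM (𝕜 := ℝ) A) := by
  refine CrossPositive.of_exp_mem hC.isInnerSelfDual fun t ht x hx => ?_
  refine hA (fun s => WithLp.ofLp (NormedSpace.exp (s • toEuclideanCLM (𝕜 := ℝ) A) x)) ?_ ?_ t ht
  · intro s _
    have h := (PiLp.continuousLinearEquiv 2 ℝ (fun _ : Fin n => ℝ)).hasFDerivAt.comp_hasDerivAt s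
      (hasDerivAt_exp_smul_apply (toEuclideanCLM (𝕜 := ℝ) A) x s)
    exact h.hasDerivWithinAt
  · rw [exp_zero_smul_apply]
    exact hx

lemma IsHurwitz.isUnit_smul_one_sub {A : Matrix (Fin n) (Fin n) ℝ} (hA : IsHurwitz A) {s : ℝ}
    (hs : 0 ≤ s) :
    IsUnit (s • (1 : EuclideanSpace ℝ (Fin n) →L[ℝ] EuclideanSpace ℝ (Fin n)) -
      toEuclideanCLM (𝕜 := ℝ) A) := by
  have hnot : (s : ℂ) ∉ spectrum ℂ (A.map (fun a : ℝ => (a : ℂ))) := fun h =>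
    absurd (hA _ h) (by simpa using hs)
  rw [spectrum.notMem_iff, isUnit_iff_isUnit_det] at hnot
  have hmap : algebraMap ℂ (Matrix (Fin n) (Fin n) ℂ) s - A.map (fun a : ℝ => (a : ℂ)) =
      Complex.ofRealHom.mapMatrix (s • (1 : Matrix (Fin n) (Fin n) ℝ) - A) := by
    ext i j
    by_cases hij : i = j <;> simp [algebraMap_matrix_apply, hij, one_apply]
  rw [hmap, ← RingHom.map_det] at hnot
  have hdet : IsUnit (s • (1 : Matrix (Fin n) (Fin n) ℝ) - A).det :=
    isUnit_iff_ne_zero.2 fun h0 => by simp [h0] at hnot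
  have h := ((isUnit_iff_isUnit_det _).2 hdet).map (toEuclideanCLM (n := Fin n) (𝕜 := ℝ))
  rwa [map_sub, map_smul, map_one] at h

end Matrices

end ConeLyapunov

theorem mainTheorem1 {n : ℕ} (C : Set (Fin n → ℝ))
    (hproper : ConeLyapunov.IsProperCone C)
    (hhom : ConeLyapunov.IsHomogeneous C)
    (hdual : ConeLyapunov.IsSelfDual C)
    (A : Matrix (Fin n) (Fin n) ℝ)
    (hA : A ∈ ConeLyapunov.invariantMatrices C)
    (hHurwitz : ConeLyapunov.IsHurwitz A) :
    ∃ P : Matrix (Fin n) (Fin n) ℝ,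
      P.IsSymm ∧
      P ∈ ConeLyapunov.coneAut C ∧
      ConeLyapunov.IsLyapunovFunction A (fun x => x ⬝ᵥ (P *ᵥ x)) ∧
      (-(P * A + Aᵀ * P)).PosDef := by
  open ConeLyapunov in
  have hC := hdual.isInnerSelfDual
  have hne : (interior (euclideanSet C)).Nonempty := by
    obtain ⟨c, hc⟩ := hproper.interior_nonempty
    exact ⟨WithLp.toLp 2 c, mem_interior_euclideanSet.2 hc⟩
  have htrans : ∀ x ∈ interior (euclideanSet C), ∀ y ∈ interior (euclideanSet C),
      ∃ p ∈ autPairs (euclideanSet C), p.1 x = y := by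
    intro x hx y hy
    obtain ⟨L, hL, hLxy⟩ := hhom _ (mem_interior_euclideanSet.1 hx) _
      (mem_interior_euclideanSet.1 hy)
    exact ⟨_, coneAut.autPairs_mem hproper.interior_nonempty hL, WithLp.ofLp_injective 2 hLxy⟩
  obtain ⟨p, hp, hneg⟩ := exists_autPairs_inner_neg hC hne htrans
    (invariantMatrices.crossPositive hdual hA) fun s hs => hHurwitz.isUnit_smul_one_sub hs
  set Φ := toEuclideanCLM (n := Fin n) (𝕜 := ℝ) with hΦ
  set P : Matrix (Fin n) (Fin n) ℝ := Φ.symm (star p.1 * p.1) with hPdef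
  have hΦP : Φ P = star p.1 * p.1 := Φ.apply_symm_apply _
  have hsymm : P.IsSymm := by
    have hΦstar : Φ (star P) = Φ P := by rw [map_star, hΦP, star_mul, star_star]
    have h : star P = P := Φ.injective hΦstar
    rwa [star_eq_conjTranspose, conjTranspose_eq_transpose_of_trivial] at h
  have hform : ∀ x y : Fin n → ℝ,
      x ⬝ᵥ (P *ᵥ y) = inner ℝ (p.1 (WithLp.toLp 2 x)) (p.1 (WithLp.toLp 2 y)) := by
    intro x y
    have h := inner_toEuclideanCLM P (WithLp.toLp 2 x) (WithLp.toLp 2 y)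
    rw [← ContinuousLinearMap.adjoint_inner_right, ← ContinuousLinearMap.star_eq_adjoint,
      ← mul_apply_eq_comp, ← hΦP]
    exact h.symm
  have hneg' : ∀ x : Fin n → ℝ, x ≠ 0 → x ⬝ᵥ (P *ᵥ (A *ᵥ x)) < 0 := by
    intro x hx
    rw [hform]
    exact hneg (WithLp.toLp 2 x) fun h => hx (WithLp.toLp_injective 2 h)
  refine ⟨P, hsymm, ?_, ?_, ?_⟩
  · exact coneAut.mem_of_autPairs (autPairs.mul_mem (autPairs.adjoint_mem hC hp) hp) hΦP
  · set F : (Fin n → ℝ) →L[ℝ] EuclideanSpace ℝ (Fin n) :=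
      p.1 ∘L ((PiLp.continuousLinearEquiv 2 ℝ (fun _ : Fin n => ℝ)).symm :
        (Fin n → ℝ) →L[ℝ] EuclideanSpace ℝ (Fin n)) with hF
    have hFapp : ∀ x, F x = p.1 (WithLp.toLp 2 x) := fun x => rfl
    have hV : (fun x : Fin n → ℝ => x ⬝ᵥ (P *ᵥ x)) = fun x => ‖F x‖ ^ 2 := by
      funext x
      rw [hform, real_inner_self_eq_norm_sq, hFapp]
    refine ⟨?_, by simp, fun x hx => ?_, fun x hx => ?_⟩
    · rw [hV]
      exact F.contDiff.norm_sq ℝ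
    · rw [hform, real_inner_self_eq_norm_sq]
      refine pow_pos (norm_pos_iff.2 fun h => hx (WithLp.toLp_injective 2 ?_)) 2
      rw [← autPairs.snd_fst hp (WithLp.toLp 2 x), h, map_zero, WithLp.toLp_zero]
    · have hd : HasFDerivAt (fun x => ‖F x‖ ^ 2) _ x := F.hasFDerivAt.norm_sq
      rw [hV, hd.fderiv]
      have h := hneg' x hx
      rw [hform] at h
      simpa [hFapp] using mul_neg_of_pos_of_neg two_pos h
  · refine Matrix.PosDef.of_dotProduct_mulVec_pos ?_ fun x hx => ?_
    · rw [IsHermitian, conjTranspose_eq_transpose_of_trivial, transpose_neg, transpose_add,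
        transpose_mul, transpose_mul, transpose_transpose, hsymm.eq, add_comm]
    · have h1 : x ⬝ᵥ ((Aᵀ * P) *ᵥ x) = x ⬝ᵥ (P *ᵥ (A *ᵥ x)) := by
        rw [← mulVec_mulVec, dotProduct_mulVec, vecMul_transpose, hform, hform, real_inner_comm]
      have h := hneg' x hx
      rw [star_trivial, neg_mulVec, dotProduct_neg, add_mulVec, dotProduct_add, h1,
        ← mulVec_mulVec]
      linarith
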